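/- Let $p$ be an odd prime and $n\ge 1$. Let $\mathrm{Pow}^*(\mathbb{Z}_{p^n})$ be the punctured power digraph of the cyclic group $\mathbb{Z}_{p^n}$: its vertices are the $p^n-1$ non-identity elements, and there is exactly one edge from $x$ to $y$ if $x\neq y$ and $y$ is a power of $x$ (an integer multiple of $x$, in additive notation), and no edge otherwise. Let $A$ be its adjacency matrix, whose $(x,y)$ entry is the number of edges from $x$ to $y$, and let $M(p^n)=I-A^{t}$, an integer matrix of size $(p^n-1)\times(p^n-1)$. For $1\le k\le p^n-1$ let $d_k\geq 0$ be the greatest common divisor of the determinants of all $k\times k$ submatrices of $M(p^n)$ (with the convention that $d_k=0$ if all of them vanish). Then \[ d_k=\begin{cases} 1, & 1\le k\le n,\\ 2^{k-n}, & n+1\le k\le p^n-n-1,\\ 2^{2k-p^n+1}, & p^n-n\le k\le p^n-2,\\ \left|\prod_{i=1}^n \bigl(2-\varphi(p^i)\bigr)\,2^{\varphi(p^i)-1}\right|, & k=p^n-1, \end{cases} \] where $\varphi$ is Euler's totient function. -/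

import Mathlib

/-- The adjacency matrix of a directed graph: the `(u, v)` entry is the number of edges from `u`
to `v`, which is `0` or `1` because a `Digraph` has no multiple edges. -/
noncomputable def Digraph.adjacencyMatrix {V : Type*} (E : Digraph V) : Matrix V V ℤ :=
  open Classical in Matrix.of fun u v => if E.Adj u v then 1 else 0

/-- The power digraph of a group: an edge from `x` to `y` when `x ≠ y` and `y` is a power of `x`. -/
def powerDigraph (G : Type*) [Group G] : Digraph G where
  Adj x y := x ≠ y ∧ ∃ m : ℤ, y = x ^ m

/-- The punctured power digraph of a group: the identity is removed from the power digraph. -/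
def puncturedPowerDigraph (G : Type*) [Group G] : Digraph {x : G // x ≠ 1} where
  Adj x y := (powerDigraph G).Adj x y

/-- The non-negative greatest common divisor of the `k × k` minors of an integer matrix. A choice of
`k` rows and `k` columns is given by two injections; listing the same rows or columns in another
order changes the minor at most by a sign. -/
noncomputable def gcdMinors {R C : Type*} [Fintype R] [Fintype C] (M : Matrix R C ℤ) (k : ℕ) : ℤ :=
  open Classical in
  (Finset.univ : Finset ((Fin k ↪ R) × (Fin k ↪ C))).gcd fun s => (M.submatrix s.1 s.2).det

/-- The matrix `I - Aᵗ`, where `A` is the adjacency matrix of the punctured power digraph of the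
cyclic group `ℤ/pⁿℤ` (written multiplicatively). -/
noncomputable def powMatrix (p n : ℕ) :
    Matrix {x : Multiplicative (ZMod (p ^ n)) // x ≠ 1}
      {x : Multiplicative (ZMod (p ^ n)) // x ≠ 1} ℤ :=
  open Classical in
  1 - (puncturedPowerDigraph (Multiplicative (ZMod (p ^ n)))).adjacencyMatrix.transpose

/-! In a cyclic group `x` is a power of `y` exactly when the order of `x` divides that of `y`. So if
U is the incidence matrix of the `n` order levels and T the matrix of `i ≤ j` on levels, the matrix
is 2 - UᵀTU. Determinantal divisors are unchanged by unimodular row and column operations. One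
element per level gives U = (1, V), and `gcdMinors_two_sub_conj_eq` leads to the blocks 2T⁻¹ - UUᵀ,
0, -Vᵀ, 2. Here UUᵀ is diagonal with entries φ(pⁱ), even because `p` is odd, and T⁻¹ is bidiagonal.
Hence the corner is 2B, with B bidiagonal: 1 - φ(pⁱ)/2 on the diagonal, -1 above it. A second
element per level gives V = (1, L) and splits off a scalar block 2
(`gcdMinors_fromBlocks_fromRows_eq`). The rest becomes diag(1, 4B) (`gcdMinors_fromBlocks_two_eq`),
and B reduces to diag(1, …, 1, det B) (`exists_bidiagonal_smith`). The Smith form thus has `n` ones,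
pⁿ - 1 - 2n twos, `n - 1` fours and 4 det B; d_k is the absolute value of the product of the first
`k`. -/

section GcdMinors

/-! ### Determinantal divisors and unimodular equivalence. -/

variable {R C R' C' : Type*} [Fintype R] [Fintype C] [Fintype R'] [Fintype C']

theorem dvd_gcdMinors_iff {M : Matrix R C ℤ} {k : ℕ} {a : ℤ} :
    a ∣ gcdMinors M k ↔ ∀ (s : Fin k ↪ R) (t : Fin k ↪ C), a ∣ (M.submatrix s t).det := by
  simp [gcdMinors, Finset.dvd_gcd_iff]

/-- Repeated rows or columns give determinant 0, so injectivity can be dropped; the multilinear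
expansion of a product needs this. -/
theorem gcdMinors_dvd_det (M : Matrix R C ℤ) {k : ℕ} (s : Fin k → R) (t : Fin k → C) :
    gcdMinors M k ∣ (M.submatrix s t).det := by
  by_cases hs : Function.Injective s
  · by_cases ht : Function.Injective t
    · exact dvd_gcdMinors_iff.1 dvd_rfl ⟨s, hs⟩ ⟨t, ht⟩
    · obtain ⟨i, j, hij, hne⟩ : ∃ i j, t i = t j ∧ i ≠ j := by
        simpa [Function.Injective] using ht
      rw [Matrix.det_zero_of_column_eq hne (fun r => by simp [hij])]
      exact dvd_zero _
  · obtain ⟨i, j, hij, hne⟩ : ∃ i j, s i = s j ∧ i ≠ j := by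
      simpa [Function.Injective] using hs
    rw [Matrix.det_zero_of_row_eq hne (by ext; simp [hij])]
    exact dvd_zero _

theorem gcdMinors_eq_of_dvd_of_dvd {M : Matrix R C ℤ} {N : Matrix R' C' ℤ} {k : ℕ}
    (h : gcdMinors M k ∣ gcdMinors N k) (h' : gcdMinors N k ∣ gcdMinors M k) :
    gcdMinors M k = gcdMinors N k :=
  dvd_antisymm_of_normalize_eq Finset.normalize_gcd Finset.normalize_gcd h h'

theorem gcdMinors_dvd_gcdMinors_submatrix (M : Matrix R C ℤ) (k : ℕ) (e : R' → R) (f : C' → C) :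
    gcdMinors M k ∣ gcdMinors (M.submatrix e f) k :=
  dvd_gcdMinors_iff.2 fun s t => by
    rw [Matrix.submatrix_submatrix]
    exact gcdMinors_dvd_det _ _ _

theorem gcdMinors_submatrix_equiv (M : Matrix R C ℤ) (k : ℕ) (e : R' ≃ R) (f : C' ≃ C) :
    gcdMinors (M.submatrix e f) k = gcdMinors M k := by
  refine gcdMinors_eq_of_dvd_of_dvd ?_ (gcdMinors_dvd_gcdMinors_submatrix M k e f)
  simpa using gcdMinors_dvd_gcdMinors_submatrix (M.submatrix e f) k e.symm f.symm

theorem gcdMinors_transpose (M : Matrix R C ℤ) (k : ℕ) :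
    gcdMinors M.transpose k = gcdMinors M k := by
  refine gcdMinors_eq_of_dvd_of_dvd ?_ ?_ <;> refine dvd_gcdMinors_iff.2 fun s t => ?_
  · rw [← Matrix.det_transpose]
    exact gcdMinors_dvd_det M.transpose t s
  · rw [← Matrix.det_transpose]
    exact gcdMinors_dvd_det M t s

/-- Rows of `P * M` are combinations of rows of `M`; expanding by multilinearity writes each minor
as a combination of minors of `M`. -/
theorem gcdMinors_dvd_gcdMinors_mul_left (P : Matrix R' R ℤ) (M : Matrix R C ℤ) (k : ℕ) :
    gcdMinors M k ∣ gcdMinors (P * M) k := by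
  classical
  refine dvd_gcdMinors_iff.2 fun s t => ?_
  have h : (P * M).submatrix s t = fun i => ∑ r, P (s i) r • fun j => M r (t j) := by
    ext i j
    simp [Matrix.mul_apply]
  change gcdMinors M k ∣ Matrix.detRowAlternating.toMultilinearMap ((P * M).submatrix s t)
  rw [h, MultilinearMap.map_sum]
  refine Finset.dvd_sum fun r _ => ?_
  rw [MultilinearMap.map_smul_univ, smul_eq_mul]
  exact (gcdMinors_dvd_det M r t).mul_left _

theorem gcdMinors_mul_left [DecidableEq R] {P : Matrix R R ℤ} (hP : IsUnit P.det)
    (M : Matrix R C ℤ) (k : ℕ) : gcdMinors (P * M) k = gcdMinors M k := by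
  refine gcdMinors_eq_of_dvd_of_dvd ?_ (gcdMinors_dvd_gcdMinors_mul_left P M k)
  have := gcdMinors_dvd_gcdMinors_mul_left P⁻¹ (P * M) k
  rwa [← Matrix.mul_assoc, Matrix.nonsing_inv_mul _ hP, Matrix.one_mul] at this

theorem gcdMinors_mul_right [DecidableEq C] {Q : Matrix C C ℤ} (hQ : IsUnit Q.det)
    (M : Matrix R C ℤ) (k : ℕ) : gcdMinors (M * Q) k = gcdMinors M k := by
  rw [← gcdMinors_transpose, Matrix.transpose_mul,
    gcdMinors_mul_left (by rwa [Matrix.det_transpose]), gcdMinors_transpose]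

theorem Fin.val_le_of_strictMono {k : ℕ} {f : Fin k → ℕ} (hf : StrictMono f) (i : Fin k) :
    (i : ℕ) ≤ f i := by
  obtain ⟨i, hi⟩ := i
  induction i with
  | zero => exact Nat.zero_le _
  | succ i ih =>
    exact (ih (by omega)).trans_lt (hf (show (⟨i, by omega⟩ : Fin k) < ⟨i + 1, hi⟩ by simp))

/-- Once the chosen indices are sorted, the `i`-th is at least `i`. -/
theorem prod_range_dvd_prod_of_injective {d : ℕ → ℤ} (hd : ∀ i j, i ≤ j → d i ∣ d j) {k : ℕ}
    (t : Fin k ↪ ℕ) : ∏ i ∈ Finset.range k, d i ∣ ∏ i, d (t i) := by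
  have hc : (Finset.univ.map t).card = k := by simp
  have h : ∏ i, d (t i) = ∏ i : Fin k, d ((Finset.univ.map t).orderEmbOfFin hc i) := by
    have := Finset.prod_map Finset.univ ((Finset.univ.map t).orderEmbOfFin hc).toEmbedding d
    rw [Finset.map_orderEmbOfFin_univ, Finset.prod_map] at this
    exact this
  rw [h, Finset.prod_range]
  exact Finset.prod_dvd_prod_of_dvd _ _ fun i _ => hd _ _
    (Fin.val_le_of_strictMono ((Finset.univ.map t).orderEmbOfFin hc).strictMono i)

theorem gcdMinors_diagonal {N k : ℕ} {d : ℕ → ℤ} (hd : ∀ i j, i ≤ j → d i ∣ d j) (hk : k ≤ N) :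
    gcdMinors (Matrix.diagonal fun i : Fin N => d i) k = |∏ i ∈ Finset.range k, d i| := by
  refine dvd_antisymm_of_normalize_eq Finset.normalize_gcd (by simp [← Int.abs_eq_normalize])
    ?_ (dvd_gcdMinors_iff.2 fun s t => ?_)
  · rw [dvd_abs, Finset.prod_range, ← Matrix.det_diagonal]
    have := gcdMinors_dvd_det (Matrix.diagonal fun i : Fin N => d i) (Fin.castLE hk)
      (Fin.castLE hk)
    rwa [Matrix.submatrix_diagonal _ _ (Fin.castLE_injective hk)] at this
  · have h : (Matrix.diagonal fun i : Fin N => d i).submatrix s t =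
        (1 : Matrix (Fin N) (Fin N) ℤ).submatrix s t * Matrix.diagonal fun i => d (t i) := by
      ext i j
      rw [Matrix.mul_diagonal]
      by_cases h : s i = t j <;> simp [Matrix.one_apply, h]
    rw [h, Matrix.det_mul, Matrix.det_diagonal, abs_dvd]
    exact (prod_range_dvd_prod_of_injective hd (t.trans Fin.valEmbedding)).mul_left _

end GcdMinors

/-! ### Smith form of a bidiagonal matrix. -/

/-- The square matrix with diagonal `a`, entries `-1` just above it, and zeros elsewhere. -/
def Matrix.bidiagonal {n : ℕ} (a : Fin n → ℤ) : Matrix (Fin n) (Fin n) ℤ :=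
  Matrix.of fun i j => (if i = j then a i else 0) - if (i : ℕ) + 1 = j then 1 else 0

namespace Matrix

/-- The matrix of the relation `i ≤ j`. -/
def leMatrix (n : ℕ) : Matrix (Fin n) (Fin n) ℤ := Matrix.of fun i j => if i ≤ j then 1 else 0

theorem leMatrix_mul_bidiagonal_one (n : ℕ) : leMatrix n * bidiagonal (fun _ => 1) = 1 := by
  ext i j
  simp only [mul_apply, leMatrix, bidiagonal, of_apply, mul_sub, Finset.sum_sub_distrib]
  simp only [mul_ite, mul_one, mul_zero, Finset.sum_ite_eq', Finset.mem_univ, if_true, one_apply]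
  rcases j with ⟨_ | j, hj⟩
  · simp [Fin.ext_iff, Fin.le_def]
  · have h : ∀ x : Fin n, ((x : ℕ) + 1 = j + 1) ↔ x = ⟨j, by omega⟩ := fun x => by
      simp [Fin.ext_iff]
    simp only [h, Finset.sum_ite_eq', Finset.mem_univ, if_true]
    simp only [Fin.le_def, Fin.ext_iff]
    split_ifs <;> omega

/-- A bidiagonal matrix with `-1` above the diagonal is equivalent to `diag(1, …, 1, ∏ i, a i)`. -/
theorem exists_bidiagonal_smith {m : ℕ} (a : Fin (m + 1) → ℤ) :
    ∃ P Q : Matrix (Fin (m + 1)) (Fin (m + 1)) ℤ, IsUnit P.det ∧ IsUnit Q.det ∧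
      P * bidiagonal a * Q = diagonal fun i => if i = Fin.last m then ∏ i, a i else 1 := by
  -- The recurrence `y (i + 1) = a i * y i` makes `bidiagonal a` send `y` to `(0, …, 0, ∏ i, a i)`.
  set y : ℕ → ℤ := fun i => ∏ j : Fin (m + 1), if (j : ℕ) < i then a j else 1 with hy
  have hy0 : y 0 = 1 := by simp [hy]
  have hylast : y (m + 1) = ∏ i, a i := by simp only [hy, Fin.is_lt, if_true]
  have hysucc : ∀ i : Fin (m + 1), y (i + 1) = a i * y i := by
    intro i
    simp only [hy]
    rw [← Finset.mul_prod_erase _ _ (Finset.mem_univ i),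
      ← Finset.mul_prod_erase _ (fun j : Fin (m + 1) => if (j : ℕ) < i then a j else 1)
        (Finset.mem_univ i)]
    simp only [Nat.lt_succ_self, if_true, lt_irrefl, if_false, one_mul]
    congr 1
    refine Finset.prod_congr rfl fun j hj => ?_
    have : (j : ℕ) ≠ i := fun h => (Finset.ne_of_mem_erase hj) (Fin.ext h)
    simp only [show (j : ℕ) < i + 1 ↔ (j : ℕ) < i by omega]
  set Q₀ : Matrix (Fin (m + 1)) (Fin (m + 1)) ℤ :=
    Matrix.of fun i j => if j = 0 then y i else if i = j then 1 else 0 with hQ₀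
  have hQ₀det : Q₀.det = 1 := by
    rw [det_of_isLowerTriangular]
    · refine Finset.prod_eq_one fun i _ => ?_
      by_cases h : i = 0 <;> simp [hQ₀, h, hy0]
    · intro i j hij
      have h : i < j := by simpa using hij
      have h1 : i ≠ j := h.ne
      have h2 : j ≠ 0 := by rintro rfl; simp at h
      simp [hQ₀, h1, h2]
  -- Columns 1 to `m` of `bidiagonal a`, shifted left so that the entries -1 land on the diagonal,
  -- then the last basis vector.
  set W : Matrix (Fin (m + 1)) (Fin (m + 1)) ℤ := Matrix.of fun i j =>
    if j = Fin.last m then (if i = j then 1 else 0) else bidiagonal a i (j + 1) with hW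
  have hval : ∀ j : Fin (m + 1), j ≠ Fin.last m → ((j + 1 : Fin (m + 1)) : ℕ) = j + 1 :=
    fun j hj => Fin.val_add_one_of_lt (Fin.lt_last_iff_ne_last.2 hj)
  have hWdet : IsUnit W.det := by
    rw [det_of_isLowerTriangular]
    · refine (IsUnit.prod_univ_iff).2 fun i => ?_
      by_cases h : i = Fin.last m
      · simp [hW, h]
      · have h1 : i ≠ i + 1 := fun e => by have := hval i h; rw [← e] at this; omega
        simp [hW, h, bidiagonal, hval i h, h1]
    · intro i j hij
      have h : i < j := by simpa using hij
      by_cases hj : j = Fin.last m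
      · simp [hW, hj, (hj ▸ h).ne]
      · have h1 : i ≠ j + 1 := fun e => by have := hval j hj; rw [← e] at this; omega
        have h2 : i ≠ j := h.ne
        simp [hW, hj, bidiagonal, h1, hval j hj, Fin.val_inj, h2]
  have key : bidiagonal a * Q₀.submatrix id (finRotate (m + 1)) =
      W * diagonal fun i => if i = Fin.last m then ∏ i, a i else 1 := by
    ext i j
    rw [mul_diagonal, mul_apply]
    simp only [submatrix_apply, id, finRotate_apply]
    by_cases hj : j = Fin.last m
    · subst hj
      simp only [hQ₀, hW, of_apply, Fin.last_add_one, if_true, bidiagonal, sub_mul,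
        Finset.sum_sub_distrib, ite_mul, zero_mul, one_mul, Finset.sum_ite_eq, Finset.mem_univ]
      by_cases hi : i = Fin.last m
      · subst hi
        rw [Finset.sum_eq_zero, sub_zero, ← hysucc, if_pos rfl]
        · simpa using hylast
        · intro x _
          rw [if_neg]
          simp; omega
      · rw [if_neg hi, ← hysucc]
        have h : ∀ x : Fin (m + 1), ((i : ℕ) + 1 = x) ↔ i + 1 = x := fun x => by
          rw [← hval i hi, Fin.val_inj]
        simp only [h, Finset.sum_ite_eq, Finset.mem_univ, if_true, hval i hi, sub_self]
    · have h0 : j + 1 ≠ 0 := fun e => by have := hval j hj; rw [e] at this; simp at this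
      simp [hQ₀, hW, hj, h0]
  refine ⟨W⁻¹, Q₀.submatrix id (finRotate (m + 1)), ?_, ?_, ?_⟩
  · exact (isUnit_nonsing_inv_det_iff).2 hWdet
  · rw [det_permute', hQ₀det, mul_one]
    exact (Equiv.Perm.sign (finRotate (m + 1))).isUnit
  · rw [Matrix.mul_assoc, key, ← Matrix.mul_assoc, nonsing_inv_mul _ hWdet, Matrix.one_mul]

end Matrix

/-! ### Block reductions. -/

namespace Matrix

theorem two_apply_int {m : Type*} [DecidableEq m] (i j : m) :
    (2 : Matrix m m ℤ) i j = if i = j then 2 else 0 :=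
  diagonal_apply ..

section Blocks

variable {ι κ : Type*} [Fintype ι] [Fintype κ] [DecidableEq ι] [DecidableEq κ]

theorem isUnit_det_fromBlocks_zero₂₁ {A : Matrix ι ι ℤ} {D : Matrix κ κ ℤ} (hA : IsUnit A.det)
    (B : Matrix ι κ ℤ) (hD : IsUnit D.det) : IsUnit (fromBlocks A B 0 D).det := by
  rw [det_fromBlocks_zero₂₁]
  exact hA.mul hD

theorem isUnit_det_fromBlocks_zero₁₂ {A : Matrix ι ι ℤ} {D : Matrix κ κ ℤ} (hA : IsUnit A.det)
    (C : Matrix κ ι ℤ) (hD : IsUnit D.det) : IsUnit (fromBlocks A 0 C D).det := by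
  rw [det_fromBlocks_zero₁₂]
  exact hA.mul hD

theorem isUnit_det_one_int : IsUnit (1 : Matrix ι ι ℤ).det := by simp

/-- Conjugation and right multiplication bring `2 - Uᵀ T U`, with `U = (1, V)`, to block triangular
form when `T` is invertible. -/
theorem gcdMinors_two_sub_conj_eq (T S : Matrix ι ι ℤ) (hTS : T * S = 1) (V : Matrix ι κ ℤ)
    (k : ℕ) :
    gcdMinors (fromBlocks (2 - T) (-(T * V)) (-(Vᵀ * T)) ((2 : Matrix κ κ ℤ) - Vᵀ * T * V)) k =
      gcdMinors (fromBlocks (2 * S - (1 + V * Vᵀ)) 0 (-Vᵀ) (2 : Matrix κ κ ℤ)) k := by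
  have h1 := isUnit_det_fromBlocks_zero₂₁ (isUnit_det_one_int (ι := ι)) V
    (isUnit_det_one_int (ι := κ))
  have h2 := isUnit_det_fromBlocks_zero₂₁ (isUnit_det_one_int (ι := ι)) (-V)
    (isUnit_det_one_int (ι := κ))
  have hS : IsUnit S.det := isUnit_det_of_left_inverse hTS
  have h3 := isUnit_det_fromBlocks_zero₂₁ hS (0 : Matrix ι κ ℤ) (isUnit_det_one_int (ι := κ))
  -- With P = (1 V; 0 1) one has UP⁻¹ = (1, 0) and PUᵀ = (1 + VVᵀ; Vᵀ), so conjugation clears the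
  -- upper right block; `S` then cancels `T`.
  rw [← gcdMinors_mul_left h1, ← gcdMinors_mul_right h2, ← gcdMinors_mul_right h3]
  congr 1
  have two_mul_V : (2 : Matrix ι ι ℤ) * V = V * (2 : Matrix κ κ ℤ) := by
    rw [← one_add_one_eq_two, ← one_add_one_eq_two, Matrix.add_mul, Matrix.mul_add]
    simp
  simp only [fromBlocks_multiply, Matrix.mul_one, Matrix.one_mul, Matrix.mul_zero, Matrix.zero_mul,
    add_zero, zero_add, Matrix.mul_neg, Matrix.neg_mul, Matrix.sub_mul, Matrix.mul_sub,
    Matrix.add_mul, Matrix.mul_assoc, hTS, two_mul_V, neg_sub, neg_neg, neg_add]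
  congr 1 <;> abel

/-- Clearing the column `(1, Lᵀ)` in a block triangular matrix splits off a scalar block. -/
theorem gcdMinors_fromBlocks_fromRows_eq (G : Matrix ι ι ℤ) (L : Matrix ι κ ℤ) (k : ℕ) :
    gcdMinors (fromBlocks G 0 (-(fromCols (1 : Matrix ι ι ℤ) L)ᵀ)
        (2 : Matrix (ι ⊕ κ) (ι ⊕ κ) ℤ)) k =
      gcdMinors (fromBlocks (fromBlocks G 0 (-1 : Matrix ι ι ℤ) (2 : Matrix ι ι ℤ)) 0 0 (2 : Matrix κ κ ℤ)) k := by
  have h1 := isUnit_det_fromBlocks_zero₁₂ (isUnit_det_one_int (ι := ι)) Lᵀ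
    (isUnit_det_one_int (ι := κ))
  have h2 := isUnit_det_fromBlocks_zero₁₂ (isUnit_det_one_int (ι := ι)) (-Lᵀ)
    (isUnit_det_one_int (ι := κ))
  have h1' := isUnit_det_fromBlocks_zero₁₂ (isUnit_det_one_int (ι := ι)) (0 : Matrix (ι ⊕ κ) ι ℤ) h1
  have h2' := isUnit_det_fromBlocks_zero₁₂ (isUnit_det_one_int (ι := ι)) (0 : Matrix (ι ⊕ κ) ι ℤ) h2
  -- The scalar block 2 is unchanged by this conjugation.
  have hinv : fromBlocks (1 : Matrix ι ι ℤ) 0 (-Lᵀ) (1 : Matrix κ κ ℤ) *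
      ((2 : Matrix (ι ⊕ κ) (ι ⊕ κ) ℤ) * fromBlocks 1 0 Lᵀ 1) = 2 := by
    rw [(Commute.ofNat_left 2 (fromBlocks (1 : Matrix ι ι ℤ) 0 Lᵀ (1 : Matrix κ κ ℤ))).eq,
      ← Matrix.mul_assoc, fromBlocks_multiply]
    simp
  rw [← gcdMinors_mul_left h2', ← gcdMinors_mul_right h1',
    ← gcdMinors_submatrix_equiv _ _ (Equiv.sumAssoc ι ι κ) (Equiv.sumAssoc ι ι κ)]
  congr 1
  simp only [fromBlocks_multiply, Matrix.mul_one, Matrix.one_mul, Matrix.mul_zero, Matrix.zero_mul,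
    add_zero, zero_add, transpose_fromCols, Matrix.mul_neg, fromBlocks_mul_fromRows, hinv,
    transpose_one, neg_add_cancel, Matrix.mul_assoc]
  ext ((i | i) | i) ((j | j) | j) <;> simp [two_apply_int, one_apply]

/-- The block -1 serves as pivot: eliminating with it merges `2 * G` and 2 into `4 * G`, which `P`
and `Q` then diagonalize. -/
theorem gcdMinors_fromBlocks_two_eq (G Δ P Q : Matrix ι ι ℤ) (hP : IsUnit P.det)
    (hQ : IsUnit Q.det) (h : P * G * Q = Δ) (k : ℕ) :
    gcdMinors (fromBlocks (fromBlocks (2 * G) 0 (-1 : Matrix ι ι ℤ) (2 : Matrix ι ι ℤ)) 0 0 (2 : Matrix κ κ ℤ)) k =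
      gcdMinors (fromBlocks (fromBlocks (1 : Matrix ι ι ℤ) 0 0 (4 * Δ)) 0 0 (2 : Matrix κ κ ℤ)) k := by
  have h1 : IsUnit (fromBlocks (0 : Matrix ι ι ℤ) (-1) 1 (2 * G)).det := by
    refine isUnit_det_of_left_inverse (B := fromBlocks (2 * G) 1 (-1) 0) ?_
    simp [fromBlocks_multiply]
  have h2 := isUnit_det_fromBlocks_zero₂₁ (isUnit_det_one_int (ι := ι)) (2 : Matrix ι ι ℤ)
    (isUnit_det_one_int (ι := ι))
  have h3 := isUnit_det_fromBlocks_zero₂₁ (isUnit_det_one_int (ι := ι)) (0 : Matrix ι ι ℤ) hP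
  have h4 := isUnit_det_fromBlocks_zero₂₁ (isUnit_det_one_int (ι := ι)) (0 : Matrix ι ι ℤ) hQ
  have hl := h3.mul h1
  have hr := h2.mul h4
  rw [← det_mul] at hl hr
  have hl' := isUnit_det_fromBlocks_zero₂₁ hl (0 : Matrix (ι ⊕ ι) κ ℤ)
    (isUnit_det_one_int (ι := κ))
  have hr' := isUnit_det_fromBlocks_zero₂₁ hr (0 : Matrix (ι ⊕ ι) κ ℤ)
    (isUnit_det_one_int (ι := κ))
  rw [← gcdMinors_mul_left hl', ← gcdMinors_mul_right hr']
  congr 1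
  have h4 : P * (4 * G) * Q = 4 * Δ := by
    rw [← h, ← mul_assoc, ← (Commute.ofNat_left 4 P).eq]
    simp only [mul_assoc]
  rw [← h4]
  simp only [fromBlocks_multiply, Matrix.mul_one, Matrix.one_mul, Matrix.mul_zero, Matrix.zero_mul,
    add_zero, zero_add, Matrix.mul_neg, Matrix.neg_mul, neg_neg]
  have h5 : 2 * G * 2 = 4 * G := by
    rw [← (Commute.ofNat_left 2 (2 * G)).eq, ← mul_assoc]
    norm_num
  simp only [mul_assoc] at h5
  simp [Matrix.mul_assoc, h5]

end Blocks

end Matrix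

/-! ### The invariant factors and their partial products. -/

/-- The sequence `1, …, 1, 2, …, 2, 4, …, 4, 4 * c` with `n` ones, `q` twos and `n - 1` fours. -/
def invariantFactor (n q : ℕ) (c : ℤ) (i : ℕ) : ℤ :=
  if i < n then 1 else if i < n + q then 2 else if i + 1 < n + q + n then 4 else 4 * c

theorem invariantFactor_dvd (n q : ℕ) (c : ℤ) (i j : ℕ) (hij : i ≤ j) :
    invariantFactor n q c i ∣ invariantFactor n q c j := by
  unfold invariantFactor
  split_ifs
  all_goals first
    | omega
    | exact one_dvd _
    | exact dvd_rfl

theorem prod_invariantFactor_of_le {n q k : ℕ} (c : ℤ) (hk : k ≤ n) :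
    ∏ i ∈ Finset.range k, invariantFactor n q c i = 1 := by
  refine Finset.prod_eq_one fun i hi => if_pos ?_
  have := Finset.mem_range.1 hi
  omega

theorem prod_invariantFactor_add {n q k : ℕ} (c : ℤ) (hk : k ≤ q) :
    ∏ i ∈ Finset.range (n + k), invariantFactor n q c i = 2 ^ k := by
  rw [Finset.prod_range_add, prod_invariantFactor_of_le c le_rfl, one_mul,
    Finset.prod_eq_pow_card (b := 2), Finset.card_range]
  intro i hi
  have := Finset.mem_range.1 hi
  rw [invariantFactor, if_neg (by omega), if_pos (by omega)]

theorem prod_invariantFactor_add_add {n q k : ℕ} (c : ℤ) (hk : k + 1 ≤ n) :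
    ∏ i ∈ Finset.range (n + q + k), invariantFactor n q c i = 2 ^ (q + 2 * k) := by
  rw [Finset.prod_range_add, prod_invariantFactor_add c le_rfl,
    Finset.prod_eq_pow_card (b := 4), Finset.card_range, pow_add, pow_mul]
  · norm_num
  intro i hi
  have := Finset.mem_range.1 hi
  rw [invariantFactor, if_neg (by omega), if_neg (by omega), if_pos (by omega)]

theorem prod_invariantFactor_total {n q : ℕ} (c : ℤ) (hn : 1 ≤ n) :
    ∏ i ∈ Finset.range (n + q + n), invariantFactor n q c i = 2 ^ (q + 2 * n) * c := by
  obtain ⟨m, rfl⟩ := Nat.exists_eq_add_of_le' hn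
  rw [← add_assoc, Finset.prod_range_succ, prod_invariantFactor_add_add c le_rfl, invariantFactor,
    if_neg (by omega), if_neg (by omega), if_neg (by omega)]
  ring

namespace Matrix

theorem gcdMinors_smith_blocks {m q k : ℕ} {κ : Type*} [Fintype κ] [DecidableEq κ]
    (hq : Fintype.card κ = q) (c : ℤ) (hk : k ≤ m + 1 + q + (m + 1)) :
    gcdMinors (fromBlocks (fromBlocks (1 : Matrix (Fin (m + 1)) (Fin (m + 1)) ℤ) 0 0
      (4 * diagonal fun i => if i = Fin.last m then c else 1)) 0 0 (2 : Matrix κ κ ℤ)) k =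
      |∏ i ∈ Finset.range k, invariantFactor (m + 1) q c i| := by
  -- The twos are moved between the ones and the fours, so that each diagonal entry divides the
  -- next.
  let e : (Fin (m + 1) ⊕ Fin (m + 1)) ⊕ κ ≃ Fin (m + 1 + q + (m + 1)) :=
    (((Equiv.sumAssoc _ _ _).trans ((Equiv.refl _).sumCongr (Equiv.sumComm _ _))).trans
      (Equiv.sumAssoc _ _ _).symm).trans
      (((((Equiv.refl _).sumCongr (Fintype.equivFinOfCardEq hq)).trans finSumFinEquiv).sumCongr
        (Equiv.refl _)).trans finSumFinEquiv)
  rw [← gcdMinors_diagonal (invariantFactor_dvd (m + 1) q c) hk,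
    ← gcdMinors_submatrix_equiv _ _ e e]
  congr 1
  rw [submatrix_diagonal_equiv]
  have he₁ : ∀ i, (e (Sum.inl (Sum.inl i)) : ℕ) = i := fun i => by simp [e]
  have he₂ : ∀ i, (e (Sum.inl (Sum.inr i)) : ℕ) = m + 1 + q + i := fun i => by simp [e]
  have he₃ : ∀ x, (e (Sum.inr x) : ℕ) = m + 1 + (Fintype.equivFinOfCardEq hq x : ℕ) :=
    fun i => by simp [e]
  have h4 : (4 : Matrix (Fin (m + 1)) (Fin (m + 1)) ℤ) = diagonal fun _ => 4 := rfl
  rw [h4, diagonal_mul_diagonal]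
  have h₁ : ∀ i : Fin (m + 1), invariantFactor (m + 1) q c i = 1 := fun i => if_pos i.2
  have h₂ : ∀ i : Fin (m + 1), invariantFactor (m + 1) q c (m + 1 + q + i) =
      4 * if i = Fin.last m then c else 1 := fun i => by
    rw [invariantFactor, if_neg (by omega), if_neg (by omega)]
    by_cases hi : i = Fin.last m
    · subst hi
      rw [if_neg (by simp; omega), if_pos rfl]
    · have := Fin.val_lt_last hi
      rw [if_pos (by omega), if_neg hi, mul_one]
  have h₃ : ∀ i : Fin q, invariantFactor (m + 1) q c (m + 1 + i) = 2 := fun i => by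
    rw [invariantFactor, if_neg (by omega), if_pos (by omega)]
  ext ((i | i) | i) ((j | j) | j) <;>
    simp [diagonal_apply, two_apply_int, one_apply, he₁, he₂, he₃, h₁, h₂, h₃]

end Matrix

/-! ### Orders of elements and the entries of the matrix. -/

/-- With `d = orderOf y`, a cyclic group has at most `d` solutions of `g ^ d = 1`, and the powers of
`y` already supply `d` of them. -/
theorem mem_zpowers_iff_orderOf_dvd {G : Type*} [Group G] [Finite G] [IsCyclic G] {x y : G} :
    x ∈ Subgroup.zpowers y ↔ orderOf x ∣ orderOf y := by
  classical
  refine ⟨orderOf_dvd_of_mem_zpowers, fun h => ?_⟩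
  have := Fintype.ofFinite G
  have hsub : (Finset.univ.filter fun g : G => g ∈ Subgroup.zpowers y) ⊆
      Finset.univ.filter fun g : G => g ^ orderOf y = 1 := by
    intro g hg
    simp only [Finset.mem_filter, Finset.mem_univ, true_and] at hg ⊢
    exact orderOf_dvd_iff_pow_eq_one.1 (orderOf_dvd_of_mem_zpowers hg)
  have hcard : (Finset.univ.filter fun g : G => g ∈ Subgroup.zpowers y).card = orderOf y := by
    rw [← Fintype.card_zpowers, Fintype.card_subtype]
  have heq := Finset.eq_of_subset_of_card_le hsub
    (by rw [hcard]; exact IsCyclic.card_pow_eq_one_le (orderOf_pos y))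
  have hx : x ∈ Finset.univ.filter fun g : G => g ^ orderOf y = 1 := by
    simpa using orderOf_dvd_iff_pow_eq_one.1 h
  rw [← heq] at hx
  simpa using hx

section Level

variable (p n : ℕ) [hp : Fact p.Prime]

theorem exists_orderOf_eq_pow_succ (x : {x : Multiplicative (ZMod (p ^ n)) // x ≠ 1}) :
    ∃ i : Fin n, orderOf x.1 = p ^ (i.1 + 1) := by
  have h : orderOf x.1 ∣ p ^ n := by
    have := orderOf_dvd_natCard x.1
    rwa [Nat.card_congr Multiplicative.toAdd, Nat.card_zmod] at this
  obtain ⟨m, hm, hx⟩ := (Nat.dvd_prime_pow hp.out).1 h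
  have hm0 : m ≠ 0 := by
    rintro rfl
    exact x.2 (orderOf_eq_one_iff.1 (by simpa using hx))
  exact ⟨⟨m - 1, by omega⟩, by rw [hx]; congr 1; simp; omega⟩

/-- The level of a non-identity element of `ℤ/pⁿℤ` is `i` when its order is `p ^ (i + 1)`. -/
noncomputable def orderLevel (x : {x : Multiplicative (ZMod (p ^ n)) // x ≠ 1}) : Fin n :=
  (exists_orderOf_eq_pow_succ p n x).choose

theorem orderOf_eq_pow_orderLevel (x : {x : Multiplicative (ZMod (p ^ n)) // x ≠ 1}) :
    orderOf x.1 = p ^ ((orderLevel p n x).1 + 1) :=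
  (exists_orderOf_eq_pow_succ p n x).choose_spec

theorem orderLevel_eq_iff (x : {x : Multiplicative (ZMod (p ^ n)) // x ≠ 1}) (i : Fin n) :
    orderLevel p n x = i ↔ orderOf x.1 = p ^ (i.1 + 1) := by
  rw [orderOf_eq_pow_orderLevel, (Nat.pow_right_injective hp.out.two_le).eq_iff]
  simp [Fin.ext_iff]

theorem card_orderLevel_eq (i : Fin n) :
    Nat.card {x // orderLevel p n x = i} = (p ^ (i.1 + 1)).totient := by
  classical
  have : NeZero (p ^ n) := ⟨pow_ne_zero _ hp.out.ne_zero⟩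
  have hd : p ^ (i.1 + 1) ∣ Fintype.card (Multiplicative (ZMod (p ^ n))) := by
    rw [Fintype.card_multiplicative, ZMod.card]
    exact pow_dvd_pow _ i.2
  rw [← IsCyclic.card_orderOf_eq_totient hd, ← Fintype.card_subtype, ← Nat.card_eq_fintype_card]
  refine Nat.card_congr ⟨fun x => ⟨x.1.1, (orderLevel_eq_iff p n _ _).1 x.2⟩,
    fun x => ⟨⟨x.1, fun h => ?_⟩, (orderLevel_eq_iff p n _ _).2 x.2⟩, fun _ => rfl, fun _ => rfl⟩
  have := x.2
  rw [h, orderOf_one] at this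
  exact (Nat.one_lt_pow (Nat.succ_ne_zero _) hp.out.one_lt).ne this

/-- The digraph has no loops; making the relation reflexive is what turns the diagonal 1 into 2 - 1.
-/
theorem powMatrix_apply (x y : {x : Multiplicative (ZMod (p ^ n)) // x ≠ 1}) [Decidable (x = y)] :
    powMatrix p n x y = (if x = y then 2 else 0) -
      if orderLevel p n x ≤ orderLevel p n y then 1 else 0 := by
  have : NeZero (p ^ n) := ⟨pow_ne_zero _ hp.out.ne_zero⟩
  have h : (∃ m : ℤ, x.1 = y.1 ^ m) ↔ orderLevel p n x ≤ orderLevel p n y := by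
    have := mem_zpowers_iff_orderOf_dvd (x := x.1) (y := y.1)
    rw [orderOf_eq_pow_orderLevel, orderOf_eq_pow_orderLevel,
      Nat.pow_dvd_pow_iff_le_right hp.out.one_lt, Subgroup.mem_zpowers_iff] at this
    simp only [eq_comm (a := x.1)]
    rw [this, Fin.le_def]
    omega
  by_cases hxy : x = y
  · subst hxy
    simp [powMatrix, Digraph.adjacencyMatrix, puncturedPowerDigraph, powerDigraph]
  · have hyx : y ≠ x := fun e => hxy e.symm
    simp [powMatrix, Digraph.adjacencyMatrix, puncturedPowerDigraph, powerDigraph, hxy,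
      Subtype.val_inj, hyx, h]

/-- The elements of each level, with two of them singled out. -/
theorem exists_equiv_orderLevel (h2 : ∀ i : Fin n, 2 ≤ (p ^ (i.1 + 1)).totient) :
    ∃ e : Fin n ⊕ (Fin n ⊕ Σ i : Fin n, Fin ((p ^ (i.1 + 1)).totient - 2)) ≃
      {x : Multiplicative (ZMod (p ^ n)) // x ≠ 1},
      ∀ z, orderLevel p n (e z) = Sum.elim id (Sum.elim id Sigma.fst) z := by
  have : NeZero (p ^ n) := ⟨pow_ne_zero _ hp.out.ne_zero⟩
  have hcard : ∀ i : Fin n, Nonempty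
      ((PUnit.{1} ⊕ (PUnit.{1} ⊕ Fin ((p ^ (i.1 + 1)).totient - 2))) ≃
        {x // orderLevel p n x = i}) := fun i => by
    refine Finite.card_eq.1 ?_
    rw [card_orderLevel_eq]
    have := h2 i
    simp
    omega
  let e : ∀ i : Fin n, (PUnit.{1} ⊕ (PUnit.{1} ⊕ Fin ((p ^ (i.1 + 1)).totient - 2))) ≃
      {x // orderLevel p n x = i} := fun i => (hcard i).some
  let e₀ : (Σ i : Fin n, PUnit.{1} ⊕ (PUnit.{1} ⊕ Fin ((p ^ (i.1 + 1)).totient - 2))) ≃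
      Fin n ⊕ (Fin n ⊕ Σ i : Fin n, Fin ((p ^ (i.1 + 1)).totient - 2)) :=
    (Equiv.sigmaSumDistrib _ _).trans ((Equiv.sigmaPUnit _).sumCongr
      ((Equiv.sigmaSumDistrib _ _).trans ((Equiv.sigmaPUnit _).sumCongr (Equiv.refl _))))
  refine ⟨e₀.symm.trans ((Equiv.sigmaCongrRight e).trans (Equiv.sigmaFiberEquiv _)), fun z => ?_⟩
  obtain ⟨⟨i, w⟩, rfl⟩ := e₀.surjective z
  have h : orderLevel p n (e i w).1 = i := (e i w).2
  simp only [Equiv.trans_apply, Equiv.symm_apply_apply]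
  refine Eq.trans h ?_
  rcases w with _ | _ | _ <;> rfl

end Level

/-! ### Level incidence matrices and assembly of the Smith form. -/

namespace Matrix

/-- The incidence matrix of a function: the `(i, x)` entry is `1` when `l x = i`. -/
def fiberMatrix {ι κ : Type*} [DecidableEq ι] (l : κ → ι) : Matrix ι κ ℤ :=
  Matrix.of fun i x => if i = l x then 1 else 0

variable {ι κ κ' : Type*} [DecidableEq ι]

theorem mul_fiberMatrix [Fintype ι] (T : Matrix κ' ι ℤ) (l : κ → ι) :
    T * fiberMatrix l = T.submatrix id l := by
  ext i x
  simp [fiberMatrix, mul_apply]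

theorem transpose_fiberMatrix_mul [Fintype ι] (T : Matrix ι κ' ℤ) (l : κ → ι) :
    (fiberMatrix l)ᵀ * T = T.submatrix l id := by
  ext i x
  simp [fiberMatrix, mul_apply]

theorem fiberMatrix_sumElim (l : κ → ι) :
    fiberMatrix (Sum.elim id l) = fromCols 1 (fiberMatrix l) := by
  ext i (x | x) <;> rfl

theorem fiberMatrix_mul_transpose_sigma_fst [Fintype ι] (g : ι → ℕ) :
    fiberMatrix (Sigma.fst : (Σ i, Fin (g i)) → ι) *
      (fiberMatrix (Sigma.fst : (Σ i, Fin (g i)) → ι))ᵀ = diagonal fun i => (g i : ℤ) := by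
  ext i j
  rw [mul_apply, Fintype.sum_sigma]
  by_cases h : i = j <;> simp [fiberMatrix, h]

end Matrix

open Matrix in
/-- The determinantal divisors of `powMatrix p n`, through its Smith normal form. -/
theorem gcdMinors_powMatrix {p m q k : ℕ} [Fact p.Prime] (h : Fin (m + 1) → ℕ)
    (h1 : ∀ i, 1 ≤ h i) (hh : ∀ i, (p ^ (i.1 + 1)).totient = 2 * h i)
    (hq : ∑ i : Fin (m + 1), ((p ^ (i.1 + 1)).totient - 2) = q)
    (hk : k ≤ m + 1 + q + (m + 1)) :
    gcdMinors (powMatrix p (m + 1)) k =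
      |∏ i ∈ Finset.range k, invariantFactor (m + 1) q (∏ i, (1 - (h i : ℤ))) i| := by
  obtain ⟨e, he⟩ := exists_equiv_orderLevel p (m + 1) fun i => by
    have := h1 i
    rw [hh]
    omega
  obtain ⟨P, Q, hP, hQ, hPQ⟩ := exists_bidiagonal_smith fun i => 1 - (h i : ℤ)
  rw [← gcdMinors_smith_blocks (κ := Σ i : Fin (m + 1), Fin ((p ^ (i.1 + 1)).totient - 2))
    (by simpa using hq) _ hk, ← gcdMinors_fromBlocks_two_eq _ _ P Q hP hQ hPQ,
    ← gcdMinors_fromBlocks_fromRows_eq _ (fiberMatrix Sigma.fst), ← fiberMatrix_sumElim]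
  -- `1 + V * Vᵀ` is diagonal with entries φ = 2h: one for the singled-out element of the level, 2h
  -- - 1 for the others.
  have hG : ∀ V : Matrix (Fin (m + 1))
      (Fin (m + 1) ⊕ Σ i : Fin (m + 1), Fin ((p ^ (i.1 + 1)).totient - 2)) ℤ,
      V = fiberMatrix (Sum.elim id Sigma.fst) → 2 * bidiagonal (fun i => 1 - (h i : ℤ)) =
        2 * bidiagonal (fun _ => 1) - (1 + V * Vᵀ) := by
    rintro V rfl
    rw [fiberMatrix_sumElim, transpose_fromCols, fromCols_mul_fromRows,
      fiberMatrix_mul_transpose_sigma_fst]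
    have h2 : (2 : Matrix (Fin (m + 1)) (Fin (m + 1)) ℤ) = diagonal fun _ => 2 := rfl
    ext i j
    have := h1 i
    have hc : (((p ^ (i.1 + 1)).totient - 2 : ℕ) : ℤ) = 2 * h i - 2 := by
      rw [hh, Nat.cast_sub (by omega)]
      push_cast
      ring
    rw [h2]
    by_cases hij : i = j
    · subst hij
      simp only [diagonal_mul, Matrix.sub_apply, Matrix.add_apply, transpose_one, Matrix.mul_one, one_apply_eq,
        diagonal_apply_eq, hc, bidiagonal, of_apply, if_true]
      ring
    · simp [diagonal_mul, hij, bidiagonal]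
  rw [hG _ rfl, ← gcdMinors_two_sub_conj_eq (leMatrix (m + 1)) _ (leMatrix_mul_bidiagonal_one _),
    ← gcdMinors_submatrix_equiv _ _ e e]
  congr 1
  rw [mul_fiberMatrix, transpose_fiberMatrix_mul, mul_fiberMatrix]
  ext x y
  classical
  rw [submatrix_apply, powMatrix_apply, he, he]
  simp only [e.apply_eq_iff_eq]
  rcases x with x | x <;> rcases y with y | y <;>
    simp [leMatrix, two_apply_int] <;> rfl

theorem mainTheorem3 (p n : ℕ) [Fact p.Prime] (hp : Odd p) (hn : 1 ≤ n) :
    (∀ k : ℕ, 1 ≤ k → k ≤ n → gcdMinors (powMatrix p n) k = 1) ∧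
    (∀ k : ℕ, n + 1 ≤ k → k ≤ p ^ n - n - 1 →
      gcdMinors (powMatrix p n) k = 2 ^ (k - n)) ∧
    (∀ k : ℕ, p ^ n - n ≤ k → k ≤ p ^ n - 2 →
      gcdMinors (powMatrix p n) k = 2 ^ (2 * k + 1 - p ^ n)) ∧
    gcdMinors (powMatrix p n) (p ^ n - 1) =
      |∏ i ∈ Finset.Icc 1 n,
        (2 - (Nat.totient (p ^ i) : ℤ)) * 2 ^ (Nat.totient (p ^ i) - 1)| := by
  have hprime : p.Prime := Fact.out
  have hp2 : 2 < p := lt_of_le_of_ne hprime.two_le fun h => by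
    rw [← h] at hp
    exact absurd hp (by decide)
  have heven : ∀ i, ∃ h : ℕ, 1 ≤ h ∧ (p ^ (i + 1)).totient = 2 * h := fun i => by
    obtain ⟨h, hh⟩ := Nat.totient_even (n := p ^ (i + 1))
      (hp2.trans_le (Nat.le_self_pow (Nat.succ_ne_zero i) p))
    have := Nat.totient_pos.2 (pow_pos hprime.pos (i + 1))
    exact ⟨h, by omega, by omega⟩
  choose h h1 hh using heven
  obtain ⟨m, rfl⟩ := Nat.exists_eq_add_of_le' hn
  obtain ⟨q, hq⟩ : ∃ q, ∑ i : Fin (m + 1), ((p ^ (i.1 + 1)).totient - 2) = q := ⟨_, rfl⟩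
  have hsum : ∑ i : Fin (m + 1), (p ^ (i.1 + 1)).totient = q + 2 * (m + 1) := by
    rw [← hq, show 2 * (m + 1) = ∑ _i : Fin (m + 1), 2 by simp [mul_comm],
      ← Finset.sum_add_distrib]
    refine Finset.sum_congr rfl fun i _ => ?_
    have := h1 i
    rw [hh]
    omega
  -- Gauss's totient sum over the divisors of the prime power; the final 1 is φ(1), for the
  -- identity.
  have hN : p ^ (m + 1) = q + 2 * (m + 1) + 1 := by
    have := Nat.sum_divisors_prime_pow (f := Nat.totient) (k := m + 1) hprime
    rw [Nat.sum_totient, Finset.sum_range_succ', ← hsum, Finset.sum_range] at *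
    simpa using this
  have key := fun (k : ℕ) (hk : k ≤ m + 1 + q + (m + 1)) =>
    gcdMinors_powMatrix (p := p) (fun i : Fin (m + 1) => h i) (fun i => h1 i) (fun i => hh i) hq hk
  refine ⟨fun k _ hk => ?_, fun k hk hk' => ?_, fun k hk hk' => ?_, ?_⟩
  · rw [key k (by omega), prod_invariantFactor_of_le _ hk, abs_one]
  · obtain ⟨j, rfl⟩ := Nat.exists_eq_add_of_le (show m + 1 ≤ k by omega)
    rw [key _ (by omega), prod_invariantFactor_add _ (by omega), abs_of_nonneg (by positivity)]
    congr 1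
    omega
  · obtain ⟨j, rfl⟩ := Nat.exists_eq_add_of_le (show m + 1 + q ≤ k by omega)
    rw [key _ (by omega), prod_invariantFactor_add_add _ (by omega),
      abs_of_nonneg (by positivity)]
    congr 1
    omega
  · rw [show p ^ (m + 1) - 1 = m + 1 + q + (m + 1) by omega, key _ le_rfl,
      prod_invariantFactor_total _ hn, ← hsum, ← Finset.prod_pow_eq_pow_sum,
      ← Finset.prod_mul_distrib, ← Finset.prod_range
        (fun i => (2 : ℤ) ^ (p ^ (i + 1)).totient * (1 - (h i : ℤ))),
      ← Finset.Ico_add_one_right_eq_Icc, Finset.prod_Ico_eq_prod_range, Nat.add_sub_cancel]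
    congr 1
    -- Factor by factor, with φ = 2h: 2^φ (1 - h) = (2 - φ) 2^(φ - 1).
    refine Finset.prod_congr rfl fun i _ => ?_
    rw [add_comm 1 i, hh, ← Nat.sub_add_cancel (show 1 ≤ 2 * h i by have := h1 i; omega), pow_succ,
      Nat.sub_add_cancel (show 1 ≤ 2 * h i by have := h1 i; omega)]
    push_cast
    ring
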